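/- **Theorem (uniform consistency of $\vartheta(P_N,\lambda_N)$).** *Setting.* Let $X$ be a subset of a separable normed space, let $Y\subset\mathbb R$, and put $Z=X\times Y$, whose elements are written $z=(x,y)$. Let $\mathcal H_k$, with norm $\|\cdot\|_k$, be the reproducing kernel Hilbert space of real functions on $X$ with positive definite symmetric kernel $k$. Let $\mathcal F\subset\mathcal H_k$ be non-empty, let $V\subset\mathbb R$ be a closed set that contains all values $f(x)$ with $f\in\mathcal F$, $x\in X$ (for instance $V=\mathbb R$, or $V=Y$ if $Y$ is closed and every $f\in\mathcal F$ maps $X$ into $Y$), and let $c:Z\times V\to\mathbb R$ be a cost function with $c(z,f(x))\ge 0$ for all $z\in Z$, $f\in\mathcal F$. Let $\mathscr P(Z)$ be the set of Borel probability measures on $Z$. For $P\in\mathscr P(Z)$, a sample $(z^1,\dots,z^N)\in Z^N$ and $\lambda_N>0$ let $$\vartheta(P)=\inf_{f\in\mathcal F}\int_Z c(z,f(x))\,P(dz),\qquad \vartheta(P_N,\lambda_N)=\inf_{f\in\mathcal F}\Big\{\int_Z c(z,f(x))\,P_N(dz)+\lambda_N\|f\|_k^2\Big\},\qquad P_N=\frac1N\sum_{i=1}^N\delta_{z^i}.$$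 *Assumptions.* 1. (Kernel) (a) For every compact $Z_0\subset Z$ with projection $X_0$ on $X$ and every $\epsilon>0$ there is $\eta>0$ such that $\|k(\cdot,x')-k(\cdot,x)\|_k<\epsilon$ for all $x,x'\in X_0$ with $\|x'-x\|<\eta$. (b) $\beta>0$ is a constant with $\|f\|_k\le\beta$ for all $f\in\mathcal F$. 2. (Cost) (a) There is a gauge function $\phi$, that is, a continuous function $\phi:Z\to[0,\infty)$ with $\phi\ge1$ outside some compact set, such that $\phi(z)\to\infty$ as $\|z\|\to\infty$ and $c(z,f(x))\le\phi(z)$ for all $z\in Z$, $f\in\mathcal F$. (b) $c$ is continuous on $Z\times V$. 3. (Hölder) There are a measurable $r:Z\to[0,\infty)$ and $\nu\in(0,1]$ such that $|c(z,f(x))-c(z,g(x))|\le r(z)\|f-g\|_\infty^{\nu}$ for all $z\in Z$ and all $f,g\in\mathcal F$ with $\|f-g\|_\infty=\sup_{x\in X}|f(x)-g(x)|<\infty$. The $\phi$-weak topology is the coarsest topology on $\{P\in\mathscr P(Z):\int\phi\,dP<\infty\}$ for which $P\mapsto\int h\,dP$ is continuous for every continuous $h:Z\to\mathbb R$ with $|h|\le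 C(\phi+1)$ for some $C>0$. For a fixed $p>1$ and $\kappa\in\mathbb R$ let $$\mathcal M_\kappa^{\phi^p}=\Big\{P\in\mathscr P(Z):\int_Z\phi(z)^p\,P(dz)<\kappa\Big\},$$ and let $\mathcal M\subset\mathcal M_\kappa^{\phi^p}$ be compact in the $\phi$-weak topology. *Conclusion.* For every $\epsilon>0$ and $\delta>0$ there is $N_0\in\mathbb N$ such that, for all $N\ge N_0$ and all $\lambda_N$ with $0<\lambda_N\le\delta/(4\beta^2)$, $$\sup_{P\in\mathcal M}P^{\otimes N}\big(|\vartheta(P_N,\lambda_N)-\vartheta(P)|\ge\delta\big)\le\epsilon .$$ -/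

import Mathlib

open MeasureTheory Filter Topology Set
open scoped ENNReal

namespace KernelRisk

noncomputable section

/-! ### Gauge functions, the generalized moment class and its topology -/

/-- A gauge function: a continuous function `φ : Z → [0, ∞)` with `φ ≥ 1` outside a compact set. -/
structure IsGauge {Z : Type*} [TopologicalSpace Z] (φ : Z → ℝ) : Prop where
  continuous : Continuous φ
  nonneg : ∀ z, 0 ≤ φ z
  one_le : ∃ K : Set Z, IsCompact K ∧ ∀ z, z ∉ K → 1 ≤ φ z

/-- The class of probability measures `P` on `Z` with `∫ φ dP < ∞`. -/
structure GaugeMeasure {Z : Type*} [MeasurableSpace Z] (φ : Z → ℝ) where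
  /-- the underlying probability measure -/
  toProb : ProbabilityMeasure Z
  integrable : Integrable φ (toProb : Measure Z)

/-- The continuous functions `h : Z → ℝ` with `|h| ≤ C (φ + 1)` for some constant `C > 0`. -/
def growthFunctions {Z : Type*} [TopologicalSpace Z] (φ : Z → ℝ) : Set (Z → ℝ) :=
  {h | Continuous h ∧ ∃ C : ℝ, 0 < C ∧ ∀ z, |h z| ≤ C * (φ z + 1)}

/-- The `φ`-weak topology: the coarsest topology for which `P ↦ ∫ h dP` is continuous for every
`h` in `growthFunctions φ`. -/
instance phiWeakTopology {Z : Type*} [TopologicalSpace Z] [MeasurableSpace Z] (φ : Z → ℝ) :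
    TopologicalSpace (GaugeMeasure φ) :=
  ⨅ h : growthFunctions φ,
    TopologicalSpace.induced (fun P : GaugeMeasure φ => ∫ z, h.1 z ∂(P.toProb : Measure Z))
      inferInstance

/-- The class of probability measures `P` on `Z` with `∫ φ ^ p dP < κ`. -/
def momentClass {Z : Type*} [MeasurableSpace Z] (φ : Z → ℝ) (p κ : ℝ) :
    Set (ProbabilityMeasure Z) :=
  {P | ∫⁻ z, ENNReal.ofReal (φ z ^ p) ∂(P : Measure Z) < ENNReal.ofReal κ}

/-- The empirical measure `(1 / N) ∑ δ_{z i}` of a sample `z` of size `N`. -/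
def empiricalMeasure {Z : Type*} [MeasurableSpace Z] {N : ℕ} (z : Fin N → Z) : Measure Z :=
  (N : ℝ≥0∞)⁻¹ • ∑ i, Measure.dirac (z i)

/-! ### Expected risk over a class of functions in a reproducing kernel Hilbert space -/

section Risk

variable {E : Type*} [NormedAddCommGroup E] {X : Set E} {Y : Set ℝ}
  {H : Type*} [NormedAddCommGroup H] [InnerProductSpace ℝ H] [RKHS ℝ H X ℝ]

/-- The optimal value of the regularized problem `inf_{f ∈ F} E_μ[c(z, f(x))] + lam ‖f‖²`,
where `z = (x, y)`. -/
def optRiskReg [MeasurableSpace E] (c : X × Y → ℝ → ℝ) (F : Set H) (μ : Measure (X × Y))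
    (lam : ℝ) : ℝ :=
  ⨅ f : F, ((∫ z, c z ((f : H) z.1) ∂μ) + lam * ‖(f : H)‖ ^ 2)

/-- The optimal value of the problem `inf_{f ∈ F} E_μ[c(z, f(x))]`, where `z = (x, y)`. -/
def optRisk [MeasurableSpace E] (c : X × Y → ℝ → ℝ) (F : Set H) (μ : Measure (X × Y)) : ℝ :=
  ⨅ f : F, ∫ z, c z ((f : H) z.1) ∂μ

/-- Assumption on the kernel `k` of the reproducing kernel Hilbert space `H` and on the feasible
set `F`. Here `RKHS.kerFun H x 1` is the kernel section `k(·, x)` as an element of `H`. -/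
structure KernelAssumption [CompleteSpace H] (Y : Set ℝ) (F : Set H) (β : ℝ) : Prop where
  equicontinuous : ∀ Z₀ : Set (X × Y), IsCompact Z₀ → ∀ ε > 0, ∃ η > 0,
    ∀ x ∈ Prod.fst '' Z₀, ∀ x' ∈ Prod.fst '' Z₀, ‖(x' : E) - (x : E)‖ < η →
      ‖RKHS.kerFun H x' (1 : ℝ) - RKHS.kerFun H x (1 : ℝ)‖ < ε
  beta_pos : 0 < β
  norm_le : ∀ f ∈ F, ‖f‖ ≤ β

/-- Assumption on the cost function `c`: it is continuous in `(z, v)` for `z ∈ X × Y` and for `v`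
in the set `V` of prediction values, and it is dominated, uniformly over `F`, by a gauge function
`φ` that tends to infinity as `‖z‖ → ∞`. -/
structure CostAssumption (V : Set ℝ) (c : X × Y → ℝ → ℝ) (F : Set H) (φ : X × Y → ℝ) :
    Prop where
  isGauge : IsGauge φ
  coercive : Tendsto φ (Bornology.cobounded (X × Y)) atTop
  le_gauge : ∀ z : X × Y, ∀ f ∈ F, c z (f z.1) ≤ φ z
  continuousOn : ContinuousOn (fun q : (X × Y) × ℝ => c q.1 q.2) (univ ×ˢ V)

/-- Hölder assumption `|c(z, f(x)) - c(z, g(x))| ≤ r(z) ‖f - g‖_∞ ^ ν` on `F`. It says nothing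
about `f`, `g` when `‖f - g‖_∞ = ∞`. -/
def HolderAssumption [MeasurableSpace E] (c : X × Y → ℝ → ℝ) (F : Set H) : Prop :=
  ∃ (r : X × Y → ℝ) (ν : ℝ), Measurable r ∧ (∀ z, 0 ≤ r z) ∧ 0 < ν ∧ ν ≤ 1 ∧
    ∀ f ∈ F, ∀ g ∈ F, BddAbove (range fun x : X => |f x - g x|) →
      ∀ z : X × Y, |c z (f z.1) - c z (g z.1)| ≤ r z * (⨆ x : X, |f x - g x|) ^ ν

end Risk

end

end KernelRisk

namespace KernelRisk

/-! ### A weak law of large numbers that is uniform over a moment class -/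

section LawOfLargeNumbers

variable {Z : Type*} [MeasurableSpace Z]

/-! Both optimal values are infima over the same `F`, so it suffices that empirical and true risks
are close uniformly over `F`; the penalty adds at most `δ / 4`. Norm boundedness, the reproducing
property and continuity of `x ↦ k(·, x)` make `F` pointwise bounded and equicontinuous. Hence its
pointwise closure is compact, metrizable since `X` is separable, and evaluation on it is jointly
continuous. The costs thus form a family `g z t`, jointly continuous with `t` in a compact metric
space and dominated by `φ`. For such a family, the modulus of continuity in `t` decreases to zero,
and its integral does so uniformly over `M` by a Dini argument (`exists_integral_modulus_lt`). A
finite net then reduces `uniform_law_of_isCompact` to finitely many functions, handled by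
`uniform_weak_law`, whose sample size depends on `P` only through the moment bound. -/

theorem measure_pi_average_ge_of_bounded (P : Measure Z) [IsProbabilityMeasure P] {h : Z → ℝ}
    (hm : Measurable h) {T : ℝ} (hT : ∀ z, |h z| ≤ T) {η : ℝ} (hη : 0 < η) {N : ℕ} (hN : 0 < N) :
    Measure.pi (fun _ : Fin N => P) {z | η ≤ |(N : ℝ)⁻¹ * ∑ i, h (z i) - ∫ z, h z ∂P|} ≤
      ENNReal.ofReal (T ^ 2 / (N * η ^ 2)) := by
  have hN' : (0 : ℝ) < N := by exact_mod_cast hN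
  have hL : MemLp h 2 P := MemLp.of_bound hm.aestronglyMeasurable T (Eventually.of_forall hT)
  have hLi (i : Fin N) : MemLp (fun z : Fin N → Z => h (z i)) 2 (Measure.pi fun _ => P) :=
    hL.comp_measurePreserving (measurePreserving_eval (fun _ : Fin N => P) i)
  have hS : MemLp (∑ i, fun z : Fin N → Z => h (z i)) 2 (Measure.pi fun _ => P) :=
    memLp_finsetSum' _ fun i _ => hLi i
  have hmean : ∫ z, (∑ i, fun z : Fin N → Z => h (z i)) z ∂(Measure.pi fun _ => P) =
      N * ∫ z, h z ∂P := by
    simp only [Finset.sum_apply]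
    rw [integral_finsetSum _ fun i _ => (hLi i).integrable (by norm_num)]
    simp [integral_comp_eval (μ := fun _ : Fin N => P) hm.aestronglyMeasurable]
  have hvar : ProbabilityTheory.variance (∑ i, fun z : Fin N → Z => h (z i))
      (Measure.pi fun _ => P) ≤ N * T ^ 2 := by
    rw [ProbabilityTheory.variance_sum_pi (μ := fun _ : Fin N => P) (X := fun _ => h) fun _ => hL]
    -- Popoviciu's bound: half the length of `[-T, T]`, squared.
    have := ProbabilityTheory.variance_le_sq_of_bounded (μ := P) (a := -T) (b := T) (X := h)
      (Eventually.of_forall fun z => abs_le.1 (hT z)) hm.aemeasurable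
    simp only [Finset.sum_const, Finset.card_univ, Fintype.card_fin, nsmul_eq_mul]
    gcongr
    calc _ ≤ _ := this
      _ = T ^ 2 := by ring
  calc _ ≤ (Measure.pi fun _ => P) {z | N * η ≤ |(∑ i, fun z : Fin N → Z => h (z i)) z -
        ∫ z, (∑ i, fun z : Fin N → Z => h (z i)) z ∂(Measure.pi fun _ => P)|} := by
        refine measure_mono fun z hz => ?_
        simp only [mem_ofPred_eq] at hz ⊢
        rw [hmean, Finset.sum_apply]
        have : (∑ i, h (z i)) - N * ∫ z, h z ∂P =
            N * ((N : ℝ)⁻¹ * ∑ i, h (z i) - ∫ z, h z ∂P) := by field_simp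
        rw [this, abs_mul, abs_of_pos hN']
        gcongr
    _ ≤ ENNReal.ofReal (ProbabilityTheory.variance (∑ i, fun z : Fin N → Z => h (z i))
          (Measure.pi fun _ => P) / (N * η) ^ 2) :=
        ProbabilityTheory.meas_ge_le_variance_div_sq hS (by positivity)
    _ ≤ _ := by
        refine ENNReal.ofReal_le_ofReal ?_
        calc _ ≤ N * T ^ 2 / (N * η) ^ 2 := by gcongr
          _ = _ := by field_simp

theorem measure_pi_average_ge_of_nonneg (P : Measure Z) [IsProbabilityMeasure P] {h : Z → ℝ}
    (hi : Integrable h P) (h0 : ∀ z, 0 ≤ h z) {η : ℝ} (hη : 0 < η) {N : ℕ} (hN : 0 < N) :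
    Measure.pi (fun _ : Fin N => P) {z | η ≤ (N : ℝ)⁻¹ * ∑ i, h (z i)} ≤
      ENNReal.ofReal ((∫ z, h z ∂P) / η) := by
  have hN' : (0 : ℝ) < N := by exact_mod_cast hN
  have hIi (i : Fin N) : Integrable (fun z : Fin N → Z => h (z i)) (Measure.pi fun _ => P) :=
    (measurePreserving_eval (fun _ : Fin N => P) i).integrable_comp_of_integrable hi
  have hmean : ∫ z : Fin N → Z, (N : ℝ)⁻¹ * ∑ i, h (z i) ∂(Measure.pi fun _ => P) =
      ∫ z, h z ∂P := by
    rw [integral_const_mul, integral_finsetSum _ fun i _ => hIi i]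
    simp only [integral_comp_eval (μ := fun _ : Fin N => P) hi.aestronglyMeasurable,
      Finset.sum_const, Finset.card_univ, Fintype.card_fin, nsmul_eq_mul]
    field_simp
  have := mul_meas_ge_le_integral_of_nonneg (μ := Measure.pi fun _ : Fin N => P)
    (f := fun z : Fin N → Z => (N : ℝ)⁻¹ * ∑ i, h (z i))
    (Eventually.of_forall fun z => mul_nonneg (by positivity) (Finset.sum_nonneg fun i _ => h0 _))
    ((integrable_finsetSum _ fun i _ => hIi i).const_mul _) η
  rw [hmean] at this
  rw [← ofReal_measureReal]
  refine ENNReal.ofReal_le_ofReal ?_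
  rw [le_div_iff₀ hη, mul_comm]
  exact this

/-- Truncation where `φ ≤ T`: Chebyshev controls the bounded part, Markov the tail, since second
moments may be infinite when `p < 2`. -/
theorem uniform_weak_law {φ : Z → ℝ} (hφm : Measurable φ) (hφ : ∀ z, 0 ≤ φ z)
    {p κ : ℝ} (hp : 1 < p) {η ε : ℝ} (hη : 0 < η) (hε : 0 < ε) :
    ∃ N₀ : ℕ, ∀ N ≥ N₀, ∀ P : ProbabilityMeasure Z, P ∈ momentClass φ p κ →
      Integrable φ (P : Measure Z) → ∀ h : Z → ℝ, Measurable h → (∀ z, |h z| ≤ φ z) →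
      Measure.pi (fun _ : Fin N => (P : Measure Z))
        {z | η ≤ |(N : ℝ)⁻¹ * ∑ i, h (z i) - ∫ z, h z ∂(P : Measure Z)|} ≤ ENNReal.ofReal ε := by
  have hlim : Tendsto (fun T : ℝ => κ * T ^ (-(p - 1))) atTop (𝓝 0) := by
    simpa using (tendsto_rpow_neg_atTop (sub_pos.2 hp)).const_mul κ
  -- `κ T^(1-p)` bounds the tail integral. The first bound makes the tail mean negligible, the
  -- second makes Markov at level `η / 4` cost at most `ε / 2`.
  obtain ⟨T, hT0, hTη, hTε⟩ := ((eventually_gt_atTop (0 : ℝ)).and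
    ((hlim.eventually_lt_const (show 0 < η / 4 by positivity)).and
      (hlim.eventually_lt_const (show 0 < ε / 2 * (η / 4) by positivity)))).exists
  have hlimN : Tendsto (fun N : ℕ => T ^ 2 / (N * (η / 2) ^ 2)) atTop (𝓝 0) :=
    (tendsto_natCast_atTop_atTop.atTop_mul_const (by positivity)).const_div_atTop _
  obtain ⟨N₀, hN₀⟩ := eventually_atTop.1 ((eventually_gt_atTop 0).and
    (hlimN.eventually_lt_const (show 0 < ε / 2 by positivity)))
  refine ⟨N₀, fun N hN P hP hφi h hm hh => ?_⟩
  obtain ⟨hNpos, hNε⟩ := hN₀ N hN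
  have hN' : (0 : ℝ) < N := by exact_mod_cast hNpos
  set S : Set Z := {z | φ z ≤ T}
  have hS : MeasurableSet S := measurableSet_le hφm measurable_const
  have hint : Integrable h (P : Measure Z) :=
    hφi.mono' hm.aestronglyMeasurable (Eventually.of_forall hh)
  have hb : ∀ z, |S.indicator h z| ≤ T := fun z => by
    by_cases hz : z ∈ S
    · simpa [hz] using (hh z).trans hz
    · simpa [hz] using hT0.le
  have hpint : Integrable (fun z => φ z ^ p) (P : Measure Z) := by
    refine (lintegral_ofReal_ne_top_iff_integrable (hφm.pow_const p).aestronglyMeasurable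
      (Eventually.of_forall fun z => Real.rpow_nonneg (hφ z) p)).1 (ne_top_of_lt hP)
  have hpκ : ∫ z, φ z ^ p ∂(P : Measure Z) < κ := by
    have h1 : ENNReal.ofReal (∫ z, φ z ^ p ∂(P : Measure Z)) < ENNReal.ofReal κ := by
      rw [ofReal_integral_eq_lintegral_ofReal hpint
        (Eventually.of_forall fun z => Real.rpow_nonneg (hφ z) p)]
      exact hP
    exact (ENNReal.ofReal_lt_ofReal_iff'.1 h1).1
  have htail : ∫ z, |Sᶜ.indicator h z| ∂(P : Measure Z) ≤ κ * T ^ (-(p - 1)) := by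
    calc _ ≤ ∫ z, φ z ^ p * T ^ (-(p - 1)) ∂(P : Measure Z) := by
          refine integral_mono (hint.indicator hS.compl).abs (hpint.mul_const _) fun z => ?_
          have hnn : 0 ≤ φ z ^ p * T ^ (-(p - 1)) :=
            mul_nonneg (Real.rpow_nonneg (hφ z) _) (Real.rpow_nonneg hT0.le _)
          by_cases hz : z ∈ S
          · simpa [hz] using hnn
          · have hTz : T < φ z := not_le.1 hz
            simp only [mem_compl_iff, hz, not_false_eq_true, indicator_of_mem]
            refine (hh z).trans ?_
            have e : φ z ^ p = φ z * φ z ^ (p - 1) := by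
              rw [← Real.rpow_one_add' (hφ z) (by linarith)]; ring_nf
            rw [e, Real.rpow_neg hT0.le, mul_assoc]
            refine le_mul_of_one_le_right (hφ z) ?_
            rw [← div_eq_mul_inv, one_le_div (Real.rpow_pos_of_pos hT0 _)]
            exact Real.rpow_le_rpow hT0.le hTz.le (by linarith)
      _ = (∫ z, φ z ^ p ∂(P : Measure Z)) * T ^ (-(p - 1)) := integral_mul_const _ _
      _ ≤ _ := by gcongr
  have hA := measure_pi_average_ge_of_bounded (P : Measure Z) (hm.indicator hS) hb
    (show 0 < η / 2 by positivity) hNpos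
  have hB := measure_pi_average_ge_of_nonneg (P : Measure Z) (hint.indicator hS.compl).abs
    (fun z => abs_nonneg _) (show 0 < η / 4 by positivity) hNpos
  have hsplit : ∀ z, h z = S.indicator h z + Sᶜ.indicator h z := fun z => by
    by_cases hz : z ∈ S <;> simp [hz]
  have hPsplit : ∫ z, h z ∂(P : Measure Z) = ∫ z, S.indicator h z ∂(P : Measure Z) +
      ∫ z, Sᶜ.indicator h z ∂(P : Measure Z) := by
    rw [← integral_add (hint.indicator hS) (hint.indicator hS.compl)]
    exact integral_congr_ae (Eventually.of_forall hsplit)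
  refine (measure_mono fun z hz => ?_).trans ((measure_union_le _ _).trans
    ((add_le_add hA hB).trans ?_))
  · by_contra hcon
    simp only [mem_union, mem_ofPred_eq, not_or, not_le] at hcon hz
    obtain ⟨h1, h2⟩ := hcon
    have e1 : (N : ℝ)⁻¹ * ∑ i, h (z i) = (N : ℝ)⁻¹ * ∑ i, S.indicator h (z i) +
        (N : ℝ)⁻¹ * ∑ i, Sᶜ.indicator h (z i) := by
      rw [← mul_add, ← Finset.sum_add_distrib]
      simp only [← hsplit]
    have e2 : |(N : ℝ)⁻¹ * ∑ i, Sᶜ.indicator h (z i)| ≤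
        (N : ℝ)⁻¹ * ∑ i, |Sᶜ.indicator h (z i)| := by
      rw [abs_mul, abs_of_pos (by positivity)]
      gcongr
      exact Finset.abs_sum_le_sum_abs _ _
    have e3 : |∫ z, Sᶜ.indicator h z ∂(P : Measure Z)| ≤
        ∫ z, |Sᶜ.indicator h z| ∂(P : Measure Z) := abs_integral_le_integral_abs
    rw [e1, hPsplit] at hz
    -- Budget: `η / 2` for the truncated part, `η / 4` each for the empirical and the true tail.
    have h1' := abs_lt.1 h1
    have e2' := abs_le.1 e2
    have e3' := abs_le.1 e3
    refine absurd hz (not_le.2 (abs_lt.2 ⟨?_, ?_⟩)) <;> linarith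
  · rw [← ENNReal.ofReal_add (by positivity) (div_nonneg (integral_nonneg fun _ => abs_nonneg _)
      (by positivity))]
    refine ENNReal.ofReal_le_ofReal ?_
    have : (∫ z, |Sᶜ.indicator h z| ∂(P : Measure Z)) / (η / 4) ≤ ε / 2 := by
      rw [div_le_iff₀ (by positivity)]
      exact htail.trans hTε.le
    linarith

end LawOfLargeNumbers

/-! ### A uniform law of large numbers over a compact index set and a compact set of measures -/

section UniformLaw

variable {Z : Type*}

theorem continuous_integral_of_mem_growthFunctions [TopologicalSpace Z] [MeasurableSpace Z]
    {φ h : Z → ℝ} (hh : h ∈ growthFunctions φ) :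
    Continuous fun P : GaugeMeasure φ => ∫ z, h z ∂(P.toProb : Measure Z) :=
  continuous_iff_le_induced.2 (iInf_le _ (⟨h, hh⟩ : growthFunctions φ))

theorem integral_empiricalMeasure [MeasurableSpace Z] {N : ℕ} (z : Fin N → Z) {h : Z → ℝ}
    (hm : Measurable h) :
    ∫ x, h x ∂(empiricalMeasure z) = (N : ℝ)⁻¹ * ∑ i, h (z i) := by
  have hi : ∀ i ∈ Finset.univ, Integrable h (Measure.dirac (z i)) := fun i _ =>
    integrable_dirac' hm.stronglyMeasurable (by simp)
  rw [empiricalMeasure, integral_smul_measure, integral_finsetSum_measure hi]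
  simp [integral_dirac' _ _ hm.stronglyMeasurable]

variable {T : Type*} [MetricSpace T]

/-- The largest difference of the values of `g z` at two points at distance at most `ρ`. -/
noncomputable def modulus (g : Z → T → ℝ) (ρ : ℝ) (z : Z) : ℝ :=
  sSup ((fun q : T × T => |g z q.1 - g z q.2|) '' {q | dist q.1 q.2 ≤ ρ})

variable {g : Z → T → ℝ}

theorem modulus_nonneg (ρ : ℝ) (z : Z) : 0 ≤ modulus g ρ z :=
  Real.sSup_nonneg (by rintro _ ⟨q, -, rfl⟩; exact abs_nonneg _)

/-- `0 ≤ b` covers an empty set of pairs, where `sSup` is `0`. -/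
theorem modulus_le {ρ b : ℝ} {z : Z} (hb : 0 ≤ b)
    (h : ∀ s t, dist s t ≤ ρ → |g z s - g z t| ≤ b) : modulus g ρ z ≤ b :=
  Real.sSup_le (by rintro _ ⟨q, hq, rfl⟩; exact h _ _ hq) hb

variable [CompactSpace T]

theorem isCompact_dist_le (ρ : ℝ) : IsCompact {q : T × T | dist q.1 q.2 ≤ ρ} :=
  (isClosed_le (by fun_prop) continuous_const).isCompact

variable [TopologicalSpace Z]

theorem continuous_modulus (hg : Continuous fun q : Z × T => g q.1 q.2) (ρ : ℝ) :
    Continuous (modulus g ρ) := by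
  refine (isCompact_dist_le ρ).continuous_sSup (f := fun z (q : T × T) => |g z q.1 - g z q.2|) ?_
  have h1 : Continuous fun q : Z × T × T => g q.1 q.2.1 :=
    hg.comp (f := fun q : Z × T × T => (q.1, q.2.1)) (by fun_prop)
  have h2 : Continuous fun q : Z × T × T => g q.1 q.2.2 :=
    hg.comp (f := fun q : Z × T × T => (q.1, q.2.2)) (by fun_prop)
  exact (h1.sub h2).abs

theorem abs_sub_le_modulus (hg : Continuous fun q : Z × T => g q.1 q.2) {ρ : ℝ} {s t : T}
    (h : dist s t ≤ ρ) (z : Z) : |g z s - g z t| ≤ modulus g ρ z := by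
  have hz : Continuous (g z) := hg.comp (f := fun t => (z, t)) (by fun_prop)
  refine le_csSup ((isCompact_dist_le ρ).image ?_).bddAbove (mem_image_of_mem _ (x := (s, t)) h)
  exact ((hz.comp continuous_fst).sub (hz.comp continuous_snd)).abs

theorem modulus_mono (hg : Continuous fun q : Z × T => g q.1 q.2) {ρ ρ' : ℝ} (h : ρ ≤ ρ')
    (z : Z) : modulus g ρ z ≤ modulus g ρ' z :=
  modulus_le (modulus_nonneg _ _) fun _ _ hst => abs_sub_le_modulus hg (hst.trans h) z

theorem tendsto_modulus (hg : Continuous fun q : Z × T => g q.1 q.2) (z : Z) :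
    Tendsto (fun n : ℕ => modulus g (1 / ((n : ℝ) + 1)) z) atTop (𝓝 0) := by
  have hz : UniformContinuous (g z) := CompactSpace.uniformContinuous_of_continuous
    (hg.comp (f := fun t => (z, t)) (by fun_prop))
  rw [Metric.tendsto_atTop]
  intro ε hε
  obtain ⟨δ, hδ, h⟩ := Metric.uniformContinuous_iff.1 hz (ε / 2) (by positivity)
  obtain ⟨n, hn⟩ := exists_nat_one_div_lt hδ
  refine ⟨n, fun m hm => ?_⟩
  rw [Real.dist_eq, sub_zero, abs_of_nonneg (modulus_nonneg _ _)]
  refine (modulus_le (b := ε / 2) (by positivity) fun s t hst => ?_).trans_lt (by linarith)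
  refine (h (hst.trans_lt (lt_of_le_of_lt ?_ hn))).le
  exact Nat.one_div_le_one_div hm

variable [MeasurableSpace Z] [OpensMeasurableSpace Z]

/-- Dini's argument: the integrals are `φ`-weakly continuous in `P`, monotone in the radius, and
tend to zero for each `P` by domination by `φ`. So the sublevel sets form a directed open cover of
`M`. -/
theorem exists_integral_modulus_lt {φ : Z → ℝ} (hφ : IsGauge φ)
    (hg : Continuous fun q : Z × T => g q.1 q.2) (hg0 : ∀ z t, 0 ≤ g z t)
    (hgφ : ∀ z t, g z t ≤ φ z) {M : Set (GaugeMeasure φ)} (hM : IsCompact M) {η : ℝ}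
    (hη : 0 < η) :
    ∃ ρ > 0, ∀ P ∈ M, ∫ z, modulus g ρ z ∂(P.toProb : Measure Z) < η := by
  have hle : ∀ (ρ : ℝ) z, modulus g ρ z ≤ φ z := fun ρ z => modulus_le (hφ.nonneg z) fun s t _ =>
    abs_sub_le_iff.2 ⟨by linarith [hg0 z t, hgφ z s], by linarith [hg0 z s, hgφ z t]⟩
  have hint : ∀ (ρ : ℝ) (P : GaugeMeasure φ), Integrable (modulus g ρ) (P.toProb : Measure Z) :=
    fun ρ P => P.integrable.mono' (continuous_modulus hg ρ).measurable.aestronglyMeasurable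
      (Eventually.of_forall fun z => by
        rw [Real.norm_of_nonneg (modulus_nonneg _ _)]; exact hle ρ z)
  have hgrow : ∀ ρ : ℝ, modulus g ρ ∈ growthFunctions φ := fun ρ =>
    ⟨continuous_modulus hg ρ, 1, one_pos, fun z => by
      rw [abs_of_nonneg (modulus_nonneg _ _)]; linarith [hle ρ z]⟩
  obtain ⟨n, hn⟩ := hM.elim_directed_cover
    (fun n : ℕ => {P : GaugeMeasure φ |
      ∫ z, modulus g (1 / ((n : ℝ) + 1)) z ∂(P.toProb : Measure Z) < η})
    (fun n => isOpen_lt (continuous_integral_of_mem_growthFunctions (hgrow _)) continuous_const)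
    (fun P _ => by
      have hlim : Tendsto (fun n : ℕ => ∫ z, modulus g (1 / ((n : ℝ) + 1)) z
          ∂(P.toProb : Measure Z)) atTop (𝓝 (∫ _, (0 : ℝ) ∂(P.toProb : Measure Z))) :=
        tendsto_integral_of_dominated_convergence φ
          (fun n => (hint _ P).aestronglyMeasurable) P.integrable
          (fun n => Eventually.of_forall fun z => by
            rw [Real.norm_of_nonneg (modulus_nonneg _ _)]; exact hle _ z)
          (Eventually.of_forall (tendsto_modulus hg))
      rw [integral_zero] at hlim
      exact mem_iUnion.2 (hlim.eventually_lt_const hη).exists)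
    (directed_of_isDirected_le fun m n hmn P hP => lt_of_le_of_lt
      (integral_mono (hint _ P) (hint _ P) (modulus_mono hg (Nat.one_div_le_one_div hmn))) hP)
  exact ⟨_, Nat.one_div_pos_of_nat, fun P hP => hn hP⟩

theorem uniform_law_of_isCompact {φ : Z → ℝ} (hφ : IsGauge φ)
    (hg : Continuous fun q : Z × T => g q.1 q.2) (hg0 : ∀ z t, 0 ≤ g z t)
    (hgφ : ∀ z t, g z t ≤ φ z) {M : Set (GaugeMeasure φ)} (hM : IsCompact M) {p κ : ℝ}
    (hp : 1 < p) (hMκ : ∀ P ∈ M, P.toProb ∈ momentClass φ p κ) {η ε : ℝ} (hη : 0 < η)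
    (hε : 0 < ε) :
    ∃ N₀ : ℕ, ∀ N ≥ N₀, ∀ P ∈ M, Measure.pi (fun _ : Fin N => (P.toProb : Measure Z))
      {z | ∃ t, η ≤ |∫ x, g x t ∂(empiricalMeasure z) - ∫ x, g x t ∂(P.toProb : Measure Z)|} ≤
        ENNReal.ofReal ε := by
  obtain ⟨ρ, hρ, hmod⟩ := exists_integral_modulus_lt hφ hg hg0 hgφ hM
    (show 0 < η / 4 by positivity)
  obtain ⟨A, -, hAfin, hA⟩ := (isCompact_univ (X := T)).finite_cover_balls hρ
  have hgc : ∀ t, Continuous fun z => g z t := fun t =>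
    hg.comp (f := fun z => (z, t)) (by fun_prop)
  have hwc := continuous_modulus hg ρ
  have hwφ : ∀ z, modulus g ρ z ≤ φ z := fun z => modulus_le (hφ.nonneg z) fun s t _ =>
    abs_sub_le_iff.2 ⟨by linarith [hg0 z t, hgφ z s], by linarith [hg0 z s, hgφ z t]⟩
  -- The modulus joins the net because its empirical mean must be controlled too.
  set B : Set (Z → ℝ) := insert (modulus g ρ) ((fun t z => g z t) '' A)
  have hB : B.Finite := (hAfin.image _).insert _
  have hBmem : ∀ h ∈ B, Measurable h ∧ ∀ z, |h z| ≤ φ z := by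
    rintro h (rfl | ⟨t, -, rfl⟩)
    · exact ⟨hwc.measurable, fun z => by rw [abs_of_nonneg (modulus_nonneg _ _)]; exact hwφ z⟩
    · exact ⟨(hgc t).measurable, fun z => by rw [abs_of_nonneg (hg0 _ _)]; exact hgφ z t⟩
  have hcard : (0 : ℝ) < hB.toFinset.card := by
    exact_mod_cast Finset.card_pos.2 ⟨modulus g ρ, by simp [B]⟩
  obtain ⟨N₀, hN₀⟩ := uniform_weak_law hφ.continuous.measurable hφ.nonneg (κ := κ) hp
    (show 0 < η / 4 by positivity) (show 0 < ε / hB.toFinset.card by positivity)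
  refine ⟨N₀, fun N hN P hP => ?_⟩
  have hgi : ∀ t, Integrable (fun z => g z t) (P.toProb : Measure Z) := fun t =>
    P.integrable.mono' (hgc t).measurable.aestronglyMeasurable (Eventually.of_forall fun z => by
      rw [Real.norm_of_nonneg (hg0 _ _)]; exact hgφ z t)
  have hwi : Integrable (modulus g ρ) (P.toProb : Measure Z) :=
    P.integrable.mono' hwc.measurable.aestronglyMeasurable (Eventually.of_forall fun z => by
      rw [Real.norm_of_nonneg (modulus_nonneg _ _)]; exact hwφ z)
  calc _ ≤ Measure.pi (fun _ : Fin N => (P.toProb : Measure Z)) (⋃ h ∈ hB.toFinset,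
        {z | η / 4 ≤ |(N : ℝ)⁻¹ * ∑ i, h (z i) - ∫ x, h x ∂(P.toProb : Measure Z)|}) := by
        refine measure_mono ?_
        rintro z ⟨t, ht⟩
        by_contra hcon
        simp only [mem_iUnion, mem_ofPred_eq, not_exists, not_le, Finite.mem_toFinset] at hcon
        obtain ⟨s, hs, hts⟩ : ∃ s ∈ A, dist t s < ρ := by simpa using hA (mem_univ t)
        have c1 := abs_lt.1 (hcon _ (mem_insert_of_mem _ (mem_image_of_mem _ hs)))
        have c2 := abs_lt.1 (hcon _ (mem_insert _ _))
        have d1 : |(N : ℝ)⁻¹ * ∑ i, g (z i) t - (N : ℝ)⁻¹ * ∑ i, g (z i) s| ≤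
            (N : ℝ)⁻¹ * ∑ i, modulus g ρ (z i) := by
          rw [← mul_sub, ← Finset.sum_sub_distrib, abs_mul, abs_of_nonneg (by positivity)]
          gcongr
          exact (Finset.abs_sum_le_sum_abs _ _).trans
            (Finset.sum_le_sum fun i _ => abs_sub_le_modulus hg hts.le _)
        have d2 : |∫ x, g x t ∂(P.toProb : Measure Z) - ∫ x, g x s ∂(P.toProb : Measure Z)| ≤
            ∫ x, modulus g ρ x ∂(P.toProb : Measure Z) := by
          rw [← integral_sub (hgi t) (hgi s)]
          exact abs_integral_le_integral_abs.trans (integral_mono ((hgi t).sub (hgi s)).abs hwi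
            fun x => abs_sub_le_modulus hg hts.le x)
        have d3 := hmod P hP
        rw [integral_empiricalMeasure z (hgc t).measurable] at ht
        -- Moving from `t` to `s` costs less than `η / 2` empirically and `η / 4` under `P`; the
        -- deviation at `s` is below `η / 4`.
        have d1' := abs_le.1 d1
        have d2' := abs_le.1 d2
        refine absurd ht (not_le.2 (abs_lt.2 ⟨?_, ?_⟩)) <;> linarith
    _ ≤ ∑ h ∈ hB.toFinset, Measure.pi (fun _ : Fin N => (P.toProb : Measure Z))
        {z | η / 4 ≤ |(N : ℝ)⁻¹ * ∑ i, h (z i) - ∫ x, h x ∂(P.toProb : Measure Z)|} :=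
        measure_biUnion_finset_le _ _
    _ ≤ ∑ h ∈ hB.toFinset, ENNReal.ofReal (ε / hB.toFinset.card) := by
        refine Finset.sum_le_sum fun h hh => ?_
        obtain ⟨hm, hb⟩ := hBmem h (hB.mem_toFinset.1 hh)
        exact hN₀ N hN P.toProb (hMκ P hP) P.integrable h hm hb
    _ = ENNReal.ofReal ε := by
        rw [← ENNReal.ofReal_sum_of_nonneg fun _ _ => by positivity, Finset.sum_const,
          nsmul_eq_mul, mul_div_cancel₀ _ hcard.ne']

end UniformLaw

/-! ### Compactness of the feasible set in the topology of pointwise convergence -/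

section Feasible

variable {E : Type*} {X : Set E} {Y : Set ℝ}
  {H : Type*} [NormedAddCommGroup H] [InnerProductSpace ℝ H] [RKHS ℝ H X ℝ] {F : Set H} {β : ℝ}

variable (F) in
/-- The closure of `F` in the topology of pointwise convergence. -/
def pointwiseClosure : Set (X → ℝ) := closure ((fun f : H => (f : X → ℝ)) '' F)

theorem mem_pointwiseClosure {f : H} (hf : f ∈ F) : (f : X → ℝ) ∈ pointwiseClosure F :=
  subset_closure (mem_image_of_mem _ hf)

/-- A closed property of functions that holds on `F` holds on its pointwise closure. -/
theorem forall_pointwiseClosure {C : Set (X → ℝ)} (hC : IsClosed C)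
    (h : ∀ f ∈ F, (f : X → ℝ) ∈ C) {u : X → ℝ} (hu : u ∈ pointwiseClosure F) : u ∈ C :=
  closure_minimal (image_subset_iff.2 h) hC hu

variable [NormedAddCommGroup E]

/-- Closedness of `V` keeps limit values in the domain where the cost is continuous, so the bounds
survive pointwise limits. -/
theorem CostAssumption.cost_mem_Icc {V : Set ℝ} (hV : IsClosed V)
    (hFV : ∀ f ∈ F, ∀ x : X, f x ∈ V) {c : X × Y → ℝ → ℝ} {φ : X × Y → ℝ}
    (hc : ∀ z : X × Y, ∀ f ∈ F, 0 ≤ c z (f z.1)) (hcost : CostAssumption V c F φ) (z : X × Y)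
    {u : X → ℝ} (hu : u ∈ pointwiseClosure F) : c z (u z.1) ∈ Icc 0 (φ z) := by
  have hcz : ContinuousOn (c z) V :=
    hcost.continuousOn.comp (f := fun v => (z, v)) (by fun_prop) fun v hv => ⟨mem_univ _, hv⟩
  have := (hcz.preimage_isClosed_of_isClosed hV (isClosed_Icc (a := 0) (b := φ z))).preimage
    (continuous_apply (A := fun _ : X => ℝ) z.1)
  exact (forall_pointwiseClosure this
    (fun f hf => ⟨hFV f hf _, hc z f hf, hcost.le_gauge z f hf⟩) hu).2

variable [CompleteSpace H]

/-- A convergent sequence with its limit is compact, so uniform continuity on compact sets suffices.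
A fixed label in `Y` lifts this set to `X × Y`. -/
theorem KernelAssumption.continuous_kerFun (hker : KernelAssumption Y F β) (hY : Y.Nonempty) :
    Continuous fun x : X => RKHS.kerFun H x (1 : ℝ) := by
  obtain ⟨y, hy⟩ := hY
  refine continuous_iff_seqContinuous.2 fun u x hu => ?_
  have hK : IsCompact ((fun x : X => (x, (⟨y, hy⟩ : Y))) '' insert x (range u)) :=
    hu.isCompact_insert_range.image (by fun_prop)
  have hfst : ∀ x' ∈ insert x (range u),
      x' ∈ Prod.fst '' ((fun x : X => (x, (⟨y, hy⟩ : Y))) '' insert x (range u)) :=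
    fun x' hx' => ⟨_, mem_image_of_mem _ hx', rfl⟩
  rw [Metric.tendsto_nhds]
  intro ε hε
  obtain ⟨η, hη, h⟩ := hker.equicontinuous _ hK ε hε
  filter_upwards [Metric.tendsto_nhds.1 hu η hη] with n hn
  rw [Function.comp_apply, dist_eq_norm]
  refine h x (hfst x (mem_insert _ _)) (u n) (hfst _ (mem_insert_of_mem _ (mem_range_self n))) ?_
  rwa [← dist_eq_norm]

theorem KernelAssumption.abs_apply_sub_le (hker : KernelAssumption Y F β) {f : H} (hf : f ∈ F)
    (x x' : X) : |f x - f x'| ≤ β * ‖RKHS.kerFun H x (1 : ℝ) - RKHS.kerFun H x' (1 : ℝ)‖ := by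
  have hrep : ∀ x, f x = inner ℝ f (RKHS.kerFun H x (1 : ℝ)) := fun x => by simp
  rw [hrep, hrep, ← inner_sub_right]
  exact (abs_real_inner_le_norm _ _).trans (by gcongr; exact hker.norm_le f hf)

theorem KernelAssumption.abs_apply_le (hker : KernelAssumption Y F β) {f : H} (hf : f ∈ F)
    (x : X) : |f x| ≤ β * ‖RKHS.kerFun H x (1 : ℝ)‖ := by
  have hrep : ∀ x, f x = inner ℝ f (RKHS.kerFun H x (1 : ℝ)) := fun x => by simp
  rw [hrep]
  exact (abs_real_inner_le_norm _ _).trans (by gcongr; exact hker.norm_le f hf)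

theorem KernelAssumption.isCompact_pointwiseClosure (hker : KernelAssumption Y F β) :
    IsCompact (pointwiseClosure F) := by
  refine (isCompact_univ_pi fun x : X => isCompact_Icc
    (a := -(β * ‖RKHS.kerFun H x (1 : ℝ)‖)) (b := β * ‖RKHS.kerFun H x (1 : ℝ)‖)).of_isClosed_subset
    isClosed_closure fun u hu => ?_
  refine forall_pointwiseClosure (isClosed_set_pi fun _ _ => isClosed_Icc) (fun f hf x _ => ?_) hu
  exact abs_le.1 (hker.abs_apply_le hf x)

theorem KernelAssumption.abs_apply_sub_le_of_mem (hker : KernelAssumption Y F β) {u : X → ℝ}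
    (hu : u ∈ pointwiseClosure F) (x x' : X) :
    |u x - u x'| ≤ β * ‖RKHS.kerFun H x (1 : ℝ) - RKHS.kerFun H x' (1 : ℝ)‖ :=
  forall_pointwiseClosure (C := {u | |u x - u x'| ≤ _}) (isClosed_le (by fun_prop)
    continuous_const) (fun _ hf => hker.abs_apply_sub_le hf x x') hu

/-- Equicontinuity upgrades separate continuity to joint continuity. -/
theorem KernelAssumption.continuous_eval (hker : KernelAssumption Y F β) (hY : Y.Nonempty) :
    Continuous fun q : X × pointwiseClosure F => q.2.1 q.1 := by
  have hk := hker.continuous_kerFun hY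
  refine continuous_iff_continuousAt.2 fun ⟨x₀, u₀⟩ => ?_
  have h1 : Tendsto (fun q : X × pointwiseClosure F => q.2.1 x₀) (𝓝 (x₀, u₀)) (𝓝 (u₀.1 x₀)) :=
    ((continuous_apply x₀).comp (continuous_subtype_val.comp continuous_snd)).tendsto (x₀, u₀)
  have h2 : Tendsto (fun q : X × pointwiseClosure F => q.2.1 q.1 - q.2.1 x₀) (𝓝 (x₀, u₀))
      (𝓝 0) := by
    refine squeeze_zero_norm (fun q => hker.abs_apply_sub_le_of_mem q.2.2 q.1 x₀) ?_
    have : Continuous fun q : X × pointwiseClosure F =>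
        β * ‖RKHS.kerFun H q.1 (1 : ℝ) - RKHS.kerFun H x₀ (1 : ℝ)‖ :=
      continuous_const.mul ((hk.comp continuous_fst).sub continuous_const).norm
    simpa using this.tendsto (x₀, u₀)
  simpa [ContinuousAt] using h2.add h1

/-- Restriction to a countable dense set is injective on continuous functions, so by compactness it
embeds the closure in a countable product of lines. -/
theorem KernelAssumption.metrizableSpace_pointwiseClosure [SecondCountableTopology E]
    (hker : KernelAssumption Y F β) (hY : Y.Nonempty) :
    TopologicalSpace.MetrizableSpace (pointwiseClosure F) := by
  have : CompactSpace (pointwiseClosure F) :=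
    isCompact_iff_compactSpace.1 hker.isCompact_pointwiseClosure
  obtain ⟨D, hDc, hD⟩ := TopologicalSpace.exists_countable_dense X
  have : Countable D := hDc.to_subtype
  have hcont : Continuous fun (u : pointwiseClosure F) (x : D) => u.1 x :=
    continuous_pi fun x => (continuous_apply x.1).comp continuous_subtype_val
  refine (hcont.isClosedEmbedding fun u v huv => Subtype.ext ?_).isEmbedding.metrizableSpace
  have hc : ∀ u : pointwiseClosure F, Continuous u.1 := fun u =>
    (hker.continuous_eval hY).comp (f := fun x => (x, u)) (by fun_prop)
  exact (hc u).ext_on hD (hc v) fun x hx => congrFun huv ⟨x, hx⟩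

/-- The cost is jointly continuous in `z` and in the element of the pointwise closure of `F`. -/
theorem CostAssumption.continuous_cost {V : Set ℝ} (hV : IsClosed V)
    (hFV : ∀ f ∈ F, ∀ x : X, f x ∈ V) {c : X × Y → ℝ → ℝ} {φ : X × Y → ℝ}
    (hcost : CostAssumption V c F φ) (hker : KernelAssumption Y F β) (hY : Y.Nonempty) :
    Continuous fun q : (X × Y) × pointwiseClosure F => c q.1 (q.2.1 q.1.1) := by
  refine hcost.continuousOn.comp_continuous
    (f := fun q : (X × Y) × pointwiseClosure F => (q.1, q.2.1 q.1.1)) ?_ fun q =>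
    ⟨mem_univ _, ?_⟩
  · exact continuous_fst.prodMk ((hker.continuous_eval hY).comp
      (f := fun q : (X × Y) × pointwiseClosure F => (q.1.1, q.2)) (by fun_prop))
  · exact forall_pointwiseClosure (C := {u | u q.1.1 ∈ V}) (hV.preimage (continuous_apply _))
      (fun f hf => hFV f hf _) q.2.2

end Feasible

/-! ### Comparison of the optimal values -/

theorem abs_ciInf_sub_ciInf_le {ι : Type*} [Nonempty ι] {a b : ι → ℝ} {r : ℝ}
    (ha : ∀ i, 0 ≤ a i) (hb : ∀ i, 0 ≤ b i) (h : ∀ i, |a i - b i| ≤ r) :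
    |(⨅ i, a i) - ⨅ i, b i| ≤ r := by
  have ha' : BddBelow (range a) := ⟨0, by rintro _ ⟨i, rfl⟩; exact ha i⟩
  have hb' : BddBelow (range b) := ⟨0, by rintro _ ⟨i, rfl⟩; exact hb i⟩
  refine abs_sub_le_iff.2 ⟨?_, ?_⟩
  · have : (⨅ i, a i) - r ≤ ⨅ i, b i := le_ciInf fun i => by
      linarith [ciInf_le ha' i, (abs_le.1 (h i)).2]
    linarith
  · have : (⨅ i, b i) - r ≤ ⨅ i, a i := le_ciInf fun i => by
      linarith [ciInf_le hb' i, (abs_le.1 (h i)).1]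
    linarith

end KernelRisk

theorem mainTheorem5
    {E : Type*} [NormedAddCommGroup E] [NormedSpace ℝ E] [SecondCountableTopology E]
    [MeasurableSpace E] [BorelSpace E]
    {X : Set E} {Y : Set ℝ}
    {H : Type*} [NormedAddCommGroup H] [InnerProductSpace ℝ H] [CompleteSpace H] [RKHS ℝ H X ℝ]
    -- the feasible set, with predictions in the closed set `V`
    (F : Set H) (hF : F.Nonempty)
    (V : Set ℝ) (hV : IsClosed V) (hFV : ∀ f ∈ F, ∀ x : X, f x ∈ V)
    -- the cost function
    (c : X × Y → ℝ → ℝ) (hc : ∀ z : X × Y, ∀ f ∈ F, 0 ≤ c z (f z.1))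
    (β : ℝ) (φ : X × Y → ℝ)
    (hker : KernelRisk.KernelAssumption Y F β)
    (hcost : KernelRisk.CostAssumption V c F φ)
    (hholder : KernelRisk.HolderAssumption c F)
    (p : ℝ) (hp : 1 < p) (κ : ℝ)
    (M : Set (KernelRisk.GaugeMeasure φ)) (hM : IsCompact M)
    (hMκ : ∀ P ∈ M, P.toProb ∈ KernelRisk.momentClass φ p κ) :
    ∀ ε > 0, ∀ δ > 0, ∃ N₀ : ℕ, ∀ N ≥ N₀, ∀ lam : ℝ, 0 < lam → lam ≤ δ / (4 * β ^ 2) →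
      (⨆ P ∈ M, Measure.pi (fun _ : Fin N => (P.toProb : Measure (X × Y)))
        {z | δ ≤ |KernelRisk.optRiskReg c F (KernelRisk.empiricalMeasure z) lam
            - KernelRisk.optRisk c F (P.toProb : Measure (X × Y))|})
        ≤ ENNReal.ofReal ε := by
  intro ε hε δ hδ
  -- A member of `M` is needed only to see that `Y` is nonempty.
  rcases M.eq_empty_or_nonempty with rfl | ⟨P₀, -⟩
  · exact ⟨0, fun N _ lam _ _ => by simp⟩
  have hY : Y.Nonempty := by
    obtain ⟨z⟩ := P₀.toProb.nonempty
    exact ⟨z.2.1, z.2.2⟩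
  have := isCompact_iff_compactSpace.1 hker.isCompact_pointwiseClosure
  have := hker.metrizableSpace_pointwiseClosure hY
  let := TopologicalSpace.metrizableSpaceMetric (KernelRisk.pointwiseClosure F)
  have hFn : Nonempty F := hF.to_subtype
  obtain ⟨N₀, hN₀⟩ := KernelRisk.uniform_law_of_isCompact
    (g := fun (z : X × Y) (u : KernelRisk.pointwiseClosure F) => c z (u.1 z.1)) hcost.isGauge
    (hcost.continuous_cost hV hFV hker hY)
    (fun z u => (hcost.cost_mem_Icc hV hFV hc z u.2).1)
    (fun z u => (hcost.cost_mem_Icc hV hFV hc z u.2).2) hM hp hMκ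
    (show 0 < δ / 2 by positivity) hε
  refine ⟨N₀, fun N hN lam hlam hlamδ => iSup₂_le fun P hP =>
    (measure_mono fun z hz => ?_).trans (hN₀ N hN P hP)⟩
  by_contra hcon
  simp only [mem_ofPred_eq, not_exists, not_le] at hcon hz
  have hβ := hker.beta_pos
  have hreg : ∀ f ∈ F, lam * ‖f‖ ^ 2 ≤ δ / 4 := fun f hf => by
    calc lam * ‖f‖ ^ 2 ≤ δ / (4 * β ^ 2) * β ^ 2 := by
          gcongr
          exact hker.norm_le f hf
      _ = δ / 4 := by field_simp
  have hnn : ∀ (μ : Measure (X × Y)) (f : F), 0 ≤ ∫ z, c z ((f : H) z.1) ∂μ :=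
    fun μ f => integral_nonneg fun z => hc z f f.2
  -- `δ / 2` from the uniform law plus `δ / 4` from the penalty, strictly below `δ`. The infima stay
  -- over `F`; only the law uses the closure.
  have hle := KernelRisk.abs_ciInf_sub_ciInf_le (r := 3 * δ / 4)
    (a := fun f : F => (∫ x, c x ((f : H) x.1) ∂(KernelRisk.empiricalMeasure z)) +
      lam * ‖(f : H)‖ ^ 2)
    (b := fun f : F => ∫ x, c x ((f : H) x.1) ∂(P.toProb : Measure (X × Y)))
    (fun f => add_nonneg (hnn _ f) (by positivity)) (hnn _) fun f => by
      have h1 := abs_lt.1 (hcon ⟨_, KernelRisk.mem_pointwiseClosure f.2⟩)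
      have h2 := hreg f f.2
      have h3 : 0 ≤ lam * ‖(f : H)‖ ^ 2 := by positivity
      refine abs_le.2 ⟨?_, ?_⟩ <;> linarith
  rw [KernelRisk.optRiskReg, KernelRisk.optRisk] at hz
  linarith
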